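/- All homology is taken with $\mathbb Z_2$ coefficients. For a topological space $X$ let $\widetilde C_\bullet(X;\mathbb Z_2)$ be its augmented singular chain complex and let $\widetilde\beta_i(X;\mathbb Z_2)=\dim_{\mathbb Z_2}\widetilde H_i(X;\mathbb Z_2)$ (possibly $\infty$) be its reduced Betti numbers; for a simplicial complex $K$ let $\widetilde C_\bullet(K;\mathbb Z_2)$ be its augmented simplicial chain complex. A chain map $\gamma_\bullet\colon \widetilde C_\bullet(K;\mathbb Z_2)\to\widetilde C_\bullet(\mathbf R;\mathbb Z_2)$ is non-trivial if $\gamma_{-1}$ is an isomorphism. Two singular chains overlap if some singular simplex with non-zero coefficient in the first and some singular simplex with non-zero coefficient in the second have intersecting images. $K$ is a homological minor of $\mathbf R$ if there is a non-trivial chain map $\widetilde C_\bullet(K;\mathbb Z_2)\to\widetilde C_\bullet(\mathbf R;\mathbb Z_2)$ sending every two disjoint simplices of $K$ to non-overlapping chains; otherwise $K$ is a forbidden homological minor of $\mathbf R$. For a family $\mathcal F$ of subsets of $\mathbf R$ and $S\subseteq\mathbf R$ put $\operatorname{conv}_{\mathcal F}(S)=\bigcap\{F\in\mathcal F: S\subseteq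 F\}$, which is $\mathbf R$ if no member of $\mathcal F$ contains $S$. The Radon number of $\mathcal F$ is the smallest integer $r\ge 0$ such that every set $P\subseteq\mathbf R$ of cardinality $r$ has two disjoint subsets $P_1,P_2\subseteq P$ with $\operatorname{conv}_{\mathcal F}(P_1)\cap\operatorname{conv}_{\mathcal F}(P_2)\neq\emptyset$, and $\infty$ if there is no such $r$. Theorem. Let $K$ be a finite simplicial complex and let $b\ge 0$ be an integer. There is a number $r_K(b)$, depending only on $K$ and $b$, with the following property. Let $\mathbf R$ be a topological space such that $K$ is a forbidden homological minor of $\mathbf R$, and let $\mathcal F$ be a family of sets in $\mathbf R$ such that for every finite set $S\subseteq\mathbf R$, \[\widetilde\beta_i(\operatorname{conv}_{\mathcal F}S;\mathbb Z_2)\le b\quad\text{for all integers } 0\le i<\dim K.\] Then the Radon number of $\mathcal F$ is at most $r_K(b)$. -/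

import Mathlib

universe u v

noncomputable section

namespace HomMinor

section Singular

/-- The singular chains of `X` with `ℤ/2` coefficients, augmented and indexed by the number of
vertices: `SingularChain X n` is the augmented chain group in degree `n - 1`.
For `n = 0` the standard simplex is empty, so there is exactly one map from it to `X` and this is
the copy of `ℤ/2` in degree `-1`. -/
abbrev SingularChain (X : Type u) [TopologicalSpace X] (n : ℕ) : Type u :=
  C(stdSimplex ℝ (Fin n), X) →₀ ZMod 2

/-- The `i`-th face of a singular simplex with `n + 1` vertices. -/
def singularFace {X : Type u} [TopologicalSpace X] {n : ℕ} (i : Fin (n + 1))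
    (s : C(stdSimplex ℝ (Fin (n + 1)), X)) : C(stdSimplex ℝ (Fin n), X) :=
  s.comp ⟨stdSimplex.map i.succAbove, stdSimplex.continuous_map _⟩

/-- The boundary operator on augmented singular chains (signs are irrelevant modulo `2`).
For `n = 0` it is the augmentation: it sends every point to the generator in degree `-1`. -/
def singularBoundary (X : Type u) [TopologicalSpace X] (n : ℕ) :
    SingularChain X (n + 1) →ₗ[ZMod 2] SingularChain X n :=
  Finsupp.linearCombination (ZMod 2)
    (fun s => ∑ i : Fin (n + 1), Finsupp.single (singularFace i s) (1 : ZMod 2))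

/-- The reduced cycles of degree `i ≥ 0`. -/
def singularCycles (X : Type u) [TopologicalSpace X] (i : ℕ) :
    Submodule (ZMod 2) (SingularChain X (i + 1)) :=
  LinearMap.ker (singularBoundary X i)

/-- The boundaries of degree `i ≥ 0`, as a submodule of the cycles. -/
def singularBoundaries (X : Type u) [TopologicalSpace X] (i : ℕ) :
    Submodule (ZMod 2) (singularCycles X i) :=
  (LinearMap.range (singularBoundary X (i + 1))).comap (singularCycles X i).subtype

/-- The reduced singular homology of `X` in degree `i ≥ 0` with `ℤ/2` coefficients:
cycles modulo boundaries of the augmented singular chain complex. -/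
abbrev ReducedHomology (X : Type u) [TopologicalSpace X] (i : ℕ) : Type u :=
  singularCycles X i ⧸ singularBoundaries X i

/-- The `i`-th reduced Betti number over `ℤ/2`, as a cardinal, so that an infinite dimensional
homology group is not bounded by any natural number. -/
def reducedBetti (X : Type u) [TopologicalSpace X] (i : ℕ) : Cardinal.{u} :=
  Module.rank (ZMod 2) (ReducedHomology X i)

/-- Two singular chains overlap if a simplex occurring in the first one and a simplex occurring in
the second one have intersecting images; otherwise they are non-overlapping. -/
def NonOverlapping {X : Type u} [TopologicalSpace X] {m n : ℕ}
    (c : SingularChain X m) (c' : SingularChain X n) : Prop :=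
  ∀ s ∈ c.support, ∀ t ∈ c'.support, Disjoint (Set.range s) (Set.range t)

end Singular

section Simplicial

variable {V : Type v}

/-- The simplices of `K` with `n` vertices, where for `n = 0` the empty simplex is included. -/
abbrev Simplex (K : PreAbstractSimplicialComplex V) (n : ℕ) : Type v :=
  {σ : Finset V // σ.card = n ∧ (σ.Nonempty → σ ∈ K)}

open Classical in
/-- The facet of a simplex obtained by removing one of its vertices. -/
def Simplex.facet {K : PreAbstractSimplicialComplex V} {n : ℕ} (σ : Simplex K (n + 1))
    (v : {v // v ∈ σ.1}) : Simplex K n :=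
  ⟨σ.1.erase v.1, by rw [Finset.card_erase_of_mem v.2, σ.2.1]; rfl, fun h =>
    (K.isRelLowerSet_faces (σ.2.2 ⟨v.1, v.2⟩)).2 (Finset.erase_subset _ _) h⟩

/-- The augmented simplicial chains of `K` with `ℤ/2` coefficients, indexed by the number of
vertices: `SimplicialChain K n` is the augmented chain group in degree `n - 1`. -/
abbrev SimplicialChain (K : PreAbstractSimplicialComplex V) (n : ℕ) : Type v :=
  Simplex K n →₀ ZMod 2

/-- The boundary operator on augmented simplicial chains: a simplex is sent to the sum of its
facets. For `n = 0` every vertex is sent to the empty simplex. -/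
def simplicialBoundary (K : PreAbstractSimplicialComplex V) (n : ℕ) :
    SimplicialChain K (n + 1) →ₗ[ZMod 2] SimplicialChain K n :=
  Finsupp.linearCombination (ZMod 2)
    (fun σ => ∑ v : {v // v ∈ σ.1}, Finsupp.single (σ.facet v) (1 : ZMod 2))

/-- The dimension of a simplicial complex: the supremum of the dimensions of its faces
(`⊥` if there are no faces). -/
def dim (K : PreAbstractSimplicialComplex V) : WithBot ℕ∞ :=
  ⨆ σ ∈ K.faces, ((σ.card - 1 : ℕ) : WithBot ℕ∞)

end Simplicial

section Minor

variable {V : Type v}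

/-- A chain map from the augmented simplicial chains of `K` to the augmented singular chains of
`X`, both with `ℤ/2` coefficients. -/
structure AugmentedChainMap (K : PreAbstractSimplicialComplex V)
    (X : Type u) [TopologicalSpace X] where
  /-- the component in degree `n - 1` -/
  map : ∀ n : ℕ, SimplicialChain K n →ₗ[ZMod 2] SingularChain X n
  /-- compatibility with the boundary operators -/
  comm : ∀ (n : ℕ) (c : SimplicialChain K (n + 1)),
    singularBoundary X n (map (n + 1) c) = map n (simplicialBoundary K n c)

/-- A chain map is non-trivial if it is an isomorphism in degree `-1`. -/
def AugmentedChainMap.IsNontrivial {K : PreAbstractSimplicialComplex V} {X : Type u}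
    [TopologicalSpace X] (φ : AugmentedChainMap K X) : Prop :=
  Function.Bijective (φ.map 0)

/-- `K` is a homological minor of `X`: there is a non-trivial chain map that sends disjoint
simplices to non-overlapping chains. (The empty simplex is harmless here: singular simplices
without vertices have empty image.) -/
def IsHomologicalMinor (K : PreAbstractSimplicialComplex V)
    (X : Type u) [TopologicalSpace X] : Prop :=
  ∃ φ : AugmentedChainMap K X, φ.IsNontrivial ∧
    ∀ (m n : ℕ) (σ : Simplex K m) (τ : Simplex K n), Disjoint σ.1 τ.1 →
      NonOverlapping (φ.map m (Finsupp.single σ 1)) (φ.map n (Finsupp.single τ 1))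

/-- `K` is a forbidden homological minor of `X`. -/
def IsForbiddenHomologicalMinor (K : PreAbstractSimplicialComplex V)
    (X : Type u) [TopologicalSpace X] : Prop :=
  ¬ IsHomologicalMinor K X

end Minor

section Radon

variable {X : Type u}

/-- The hull of `S` with respect to a family `F` of subsets of `X`: the intersection of all
members of `F` containing `S` (all of `X` if there are none). -/
def convHull (F : Set (Set X)) (S : Set X) : Set X :=
  ⋂₀ {A | A ∈ F ∧ S ⊆ A}

/-- Every set of `r` points of `X` has two disjoint subsets whose hulls intersect. -/
def HasRadonProperty (F : Set (Set X)) (r : ℕ) : Prop :=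
  ∀ P : Finset X, P.card = r → ∃ P₁ P₂ : Finset X, P₁ ⊆ P ∧ P₂ ⊆ P ∧ Disjoint P₁ P₂ ∧
    (convHull F (P₁ : Set X) ∩ convHull F (P₂ : Set X)).Nonempty

/-- The Radon number of a family: the smallest `r` with the Radon property, and `⊤` if there is
no such `r`. -/
def radonNumber (F : Set (Set X)) : ℕ∞ :=
  ⨅ (r : ℕ) (_ : HasRadonProperty F r), (r : ℕ∞)

end Radon

end HomMinor

end

/-! Suppose `r` points are given such that the hulls of disjoint subsets never meet. Consider a
chain map from a skeleton of a simplex to `R` that sends every face `σ` into the hull of a set `Ψ σ`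
of these points, where `Ψ` preserves disjointness. If the simplex has as many vertices as `K` and
the skeleton contains `K`, the map exhibits `K` as a homological minor
(`SkeletonMap.isHomologicalMinor`). So it suffices to construct such a map when `r` is large.

The map is built one dimension at a time (`exists_skeletonMap`, with inductive step
`exists_skeletonMap_succ`). On vertices it is a choice of points. In passing from dimension `k` to
`k + 1`, the obstruction on a face is the class of a `k`-cycle in the homology of a hull. Bounded
Betti numbers leave at most `2 ^ b` classes (`exists_boundary_detector`), so Ramsey's theorem, with
constants independent of `R`, yields many vertices that span only simplices with the same boundary
class. If the barycentric subdivision of a face uses these vertices, its boundary is a sum of `(k +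
2)!` equal classes, which vanishes modulo `2` (`parity_sd`), and the face can be filled.

Distinct faces share barycentres, so these choices must be made together. `exists_spread_good` does
this: the vertex sets whose hulls receive the fillings meet only in barycentres of common subfaces,
which keeps disjoint faces over disjoint point sets. -/

noncomputable section

/-! ### Ramsey's theorem and a selection of vertices in prescribed positions -/

section Ramsey

/-- Ramsey's theorem for hypergraphs with a target size for every colour. -/
theorem exists_monochromatic_of_targets {α κ : Type*} [DecidableEq α] [Fintype κ]
    [DecidableEq κ] (n : ℕ) : ∀ m : κ → ℕ, ∃ N : ℕ, ∀ X : Finset α, N ≤ X.card →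
      ∀ χ : Finset α → κ, ∃ c, ∃ Y ⊆ X, Y.card = m c ∧ ∀ Z ⊆ Y, Z.card = n → χ Z = c := by
  induction n with
  | zero =>
    intro m
    refine ⟨∑ c, m c, fun X hX χ => ⟨χ ∅, ?_⟩⟩
    obtain ⟨Y, hY, hc⟩ := Finset.exists_subset_card_eq
      ((Finset.single_le_sum (fun _ _ => Nat.zero_le _) (Finset.mem_univ (χ ∅))).trans hX)
    refine ⟨Y, hY, hc, fun Z _ hZ => ?_⟩
    rw [Finset.card_eq_zero.1 hZ]
  | succ n ih =>
    -- Erdős–Szekeres recursion: an inner induction on the sum of the targets.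
    have key : ∀ (s : ℕ) (m : κ → ℕ), ∑ c, m c = s → ∃ N : ℕ, ∀ X : Finset α, N ≤ X.card →
        ∀ χ : Finset α → κ, ∃ c, ∃ Y ⊆ X, Y.card = m c ∧
          ∀ Z ⊆ Y, Z.card = n + 1 → χ Z = c := by
      intro s
      induction s with
      | zero =>
        intro m hm
        refine ⟨0, fun X _ χ => ⟨χ ∅, ∅, Finset.empty_subset _, ?_, ?_⟩⟩
        · rw [Finset.card_empty, (Finset.sum_eq_zero_iff.1 hm) _ (Finset.mem_univ _)]
        · intro Z hZ hc
          rw [Finset.subset_empty.1 hZ] at hc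
          simp at hc
      | succ s ihs =>
        intro m hm
        by_cases h0 : ∃ c, m c = 0
        · obtain ⟨c, hc⟩ := h0
          refine ⟨0, fun X _ χ => ⟨c, ∅, Finset.empty_subset _, by simp [hc], ?_⟩⟩
          intro Z hZ hc
          rw [Finset.subset_empty.1 hZ] at hc
          simp at hc
        push Not at h0
        have hsum : ∀ c, ∑ c', Function.update m c (m c - 1) c' = s := by
          intro c
          have h1 := Finset.sum_update_of_mem (Finset.mem_univ c) m (m c - 1)
          have h2 := Finset.add_sum_erase Finset.univ m (Finset.mem_univ c)
          rw [h1, ← Finset.erase_eq]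
          have := h0 c
          omega
        choose M hM using fun c => ihs (Function.update m c (m c - 1)) (hsum c)
        obtain ⟨N, hN⟩ := ih M
        refine ⟨N + 1, fun X hX χ => ?_⟩
        obtain ⟨x, hx⟩ := Finset.card_pos.1 (show 0 < X.card by omega)
        -- The link of `x` is coloured by `n`-sets. On `Y` the link has the single colour `c`, and
        -- `Y` is large enough for the targets with that of `c` lowered by one; if colour `c` then
        -- wins inside `Y`, adding `x` restores the lost unit.
        obtain ⟨c, Y, hYX, hYc, hY⟩ := hN (X.erase x)
          (by rw [Finset.card_erase_of_mem hx]; omega) (fun Z => χ (insert x Z))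
        obtain ⟨c', Z, hZY, hZc, hZ⟩ := hM c Y hYc.ge χ
        have hZX : Z ⊆ X := (hZY.trans hYX).trans (Finset.erase_subset _ _)
        by_cases hcc : c' = c
        · subst hcc
          have hxZ : x ∉ Z := fun h => Finset.notMem_erase x X (hYX (hZY h))
          refine ⟨c', insert x Z, Finset.insert_subset hx hZX, ?_, ?_⟩
          · rw [Finset.card_insert_of_notMem hxZ, hZc, Function.update_self]
            have := h0 c'
            omega
          · intro W hW hWc
            by_cases hxW : x ∈ W
            · rw [← Finset.insert_erase hxW]
              refine hY _ ?_ (by rw [Finset.card_erase_of_mem hxW, hWc]; rfl)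
              exact (Finset.subset_insert_iff.1 hW).trans hZY
            · exact hZ W ((Finset.subset_insert_iff_of_notMem hxW).1 hW) hWc
        · exact ⟨c', Z, hZX, by rw [hZc, Function.update_of_ne hcc], hZ⟩
    exact fun m => key _ m rfl

/-- Ramsey's theorem for `n`-uniform hypergraphs. -/
theorem exists_monochromatic (α κ : Type*) [Finite κ] (n m : ℕ) :
    ∃ N : ℕ, ∀ X : Finset α, N ≤ X.card → ∀ χ : Finset α → κ,
      ∃ c, ∃ Y ⊆ X, Y.card = m ∧ ∀ Z ⊆ Y, Z.card = n → χ Z = c := by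
  classical
  have := Fintype.ofFinite κ
  exact exists_monochromatic_of_targets n fun _ : κ => m

/-- If every `n`-set contains a good `t`-set, then on a large subset the good `t`-set can be chosen
in the same position in every `n`-set. -/
theorem exists_uniform_position (n t M : ℕ) : ∃ N : ℕ, ∀ Good : Finset ℕ → Finset ℕ → Prop,
    (∀ A ⊆ Finset.range N, A.card = n → ∃ T ⊆ A, T.card = t ∧ Good T A) →
    ∃ Y ⊆ Finset.range N, Y.card = M ∧ (n ≤ M → ∃ T : Finset (Fin n), T.card = t ∧
      ∀ f : Fin n → ℕ, StrictMono f → (∀ i, f i ∈ Y) →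
        Good (T.image f) (Finset.univ.image f)) := by
  classical
  obtain ⟨N, hN⟩ := exists_monochromatic ℕ (Finset (Fin n)) n M
  refine ⟨N, fun Good hG => ?_⟩
  choose! T hTA hTc hT using hG
  -- The colour of an `n`-set is the set of positions that its good subset occupies in the
  -- increasing enumeration.
  obtain ⟨P, Y, hYN, hYM, hY⟩ := hN (Finset.range N) (by simp) fun A =>
    if h : A.card = n then Finset.univ.filter (fun i => A.orderEmbOfFin h i ∈ T A) else ∅
  have key : ∀ f : Fin n → ℕ, StrictMono f → (∀ i, f i ∈ Y) →
      P.image f = T (Finset.univ.image f) ∧ (Finset.univ.image f).card = n ∧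
        Finset.univ.image f ⊆ Finset.range N := by
    intro f hf hfY
    have hA : (Finset.univ.image f).card = n := by
      rw [Finset.card_image_of_injective _ hf.injective]; simp
    have hAY : Finset.univ.image f ⊆ Y := by
      intro x hx
      obtain ⟨i, -, rfl⟩ := Finset.mem_image.1 hx
      exact hfY i
    refine ⟨?_, hA, hAY.trans hYN⟩
    have h := hY _ hAY hA
    rw [dif_pos hA, ← Finset.orderEmbOfFin_unique hA (f := f) (by simp) hf] at h
    rw [← h]
    ext x
    simp only [Finset.mem_image, Finset.mem_filter, Finset.mem_univ, true_and]
    constructor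
    · rintro ⟨i, hi, rfl⟩; exact hi
    · intro hx
      obtain ⟨i, -, rfl⟩ := Finset.mem_image.1 (hTA _ (hAY.trans hYN) hA hx)
      exact ⟨i, hx, rfl⟩
  refine ⟨Y, hYN, hYM, fun hnM => ⟨P, ?_, fun f hf hfY => ?_⟩⟩
  · obtain ⟨A, hAY, hA⟩ := Finset.exists_subset_card_eq (hnM.trans hYM.ge)
    obtain ⟨h1, h2, h3⟩ := key (A.orderEmbOfFin hA) (A.orderEmbOfFin hA).strictMono
      (fun i => hAY (Finset.orderEmbOfFin_mem _ _ _))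
    rw [← Finset.card_image_of_injective P (A.orderEmbOfFin hA).injective, h1]
    exact hTc _ h3 h2
  · obtain ⟨h1, h2, h3⟩ := key f hf hfY
    rw [h1]
    exact hT _ h3 h2

/-- A strictly increasing function on a subset of `Fin n` extends to `Fin n`, with values in
`ℕ × ℕ` ordered lexicographically, where the new values avoid those of other such extensions. -/
theorem exists_strictMono_lex {n : ℕ} (T : Finset (Fin n)) (Z : Finset ℕ) (hZ : Z.card = T.card)
    (s : ℕ) : ∃ f : Fin n → ℕ × ℕ, StrictMono (fun i => toLex (f i)) ∧
      T.image f = Z.image (fun j => (j + 1, 0)) ∧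
      ∀ i, i ∉ T → (f i).2 ≠ 0 ∧ (f i).2 ≤ n * (s + 1) ∧ ((f i).2 - 1) / n = s ∧
        ((f i).1 = 0 ∨ ∃ j ∈ Z, (f i).1 = j + 1) := by
  classical
  -- `c i` says after how many elements of `T` the index `i` comes, and `G q` is one more than the
  -- `q`-th element of `Z`. The value `G 0 = 0` is the block for indices that precede all of `T`.
  let c : Fin n → ℕ := fun i => (T.filter (· ≤ i)).card
  have hc : ∀ i, c i ≤ Z.card := fun i => hZ ▸ Finset.card_filter_le _ _
  let G : ℕ → ℕ := fun q => if h : 0 < q ∧ q - 1 < Z.card then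
    Z.orderEmbOfFin rfl ⟨q - 1, h.2⟩ + 1 else 0
  have hG : ∀ p q, p < q → q ≤ Z.card → G p < G q := by
    intro p q hpq hq
    have h2 : 0 < q ∧ q - 1 < Z.card := by omega
    simp only [G, dif_pos h2]
    split_ifs with h1
    · have : Z.orderEmbOfFin rfl ⟨p - 1, h1.2⟩ < Z.orderEmbOfFin rfl ⟨q - 1, h2.2⟩ := by
        rw [OrderEmbedding.lt_iff_lt, Fin.mk_lt_mk]; omega
      omega
    · omega
  have hGZ : ∀ q, G q = 0 ∨ ∃ j ∈ Z, G q = j + 1 := by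
    intro q
    by_cases h : 0 < q ∧ q - 1 < Z.card
    · exact Or.inr ⟨_, Finset.orderEmbOfFin_mem Z rfl ⟨q - 1, h.2⟩, by simp only [G, dif_pos h]⟩
    · exact Or.inl (by simp only [G, dif_neg h])
  have hcT : ∀ i ∈ T, 0 < c i := fun i hi =>
    Finset.card_pos.2 ⟨i, Finset.mem_filter.2 ⟨hi, le_rfl⟩⟩
  have hmono : ∀ i j, i < j → c i ≤ c j := fun i j hij =>
    Finset.card_le_card fun x hx => by
      rw [Finset.mem_filter] at hx ⊢
      exact ⟨hx.1, hx.2.trans hij.le⟩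
  have hstrict : ∀ i j, i < j → j ∈ T → c i < c j := fun i j hij hj =>
    Finset.card_lt_card <| by
      refine (Finset.ssubset_iff_of_subset fun x hx => ?_).2 ⟨j, ?_, ?_⟩
      · rw [Finset.mem_filter] at hx ⊢
        exact ⟨hx.1, hx.2.trans hij.le⟩
      · exact Finset.mem_filter.2 ⟨hj, le_rfl⟩
      · exact fun h => absurd (Finset.mem_filter.1 h).2 (not_le.2 hij)
  -- Elements of `T` open the blocks named by `Z`. The other indices follow in the current block,
  -- with offsets from an interval of length `n` that is reserved for the label `s`.
  let f : Fin n → ℕ × ℕ := fun i => (G (c i), if i ∈ T then 0 else 1 + s * n + i)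
  have hf : StrictMono fun i => toLex (f i) := by
    intro i j hij
    rw [Prod.Lex.toLex_lt_toLex]
    rcases (hmono i j hij).lt_or_eq with h | h
    · exact Or.inl (hG _ _ h (hc j))
    · refine Or.inr ⟨by simp only [f, h], ?_⟩
      have hj : j ∉ T := fun hj => (hstrict i j hij hj).ne h
      simp only [f, if_neg hj]
      split_ifs
      · omega
      · have : (i : ℕ) < j := hij
        omega
  refine ⟨f, hf, ?_, ?_⟩
  · refine Finset.eq_of_subset_of_card_le ?_ ?_
    · intro x hx
      obtain ⟨i, hi, rfl⟩ := Finset.mem_image.1 hx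
      have h0 := hG 0 (c i) (hcT i hi) (hc i)
      obtain h | ⟨j, hj, h⟩ := hGZ (c i)
      · omega
      · exact Finset.mem_image.2 ⟨j, hj, by simp only [f, h, if_pos hi]⟩
    · rw [Finset.card_image_of_injective T (fun i j h => hf.injective (congrArg toLex h)), ← hZ]
      exact Finset.card_image_le
  · intro i hi
    have hin := i.2
    simp only [f, if_neg hi]
    refine ⟨by omega, by nlinarith, ?_, hGZ _⟩
    rw [show 1 + s * n + (i : ℕ) - 1 = i + n * s by rw [mul_comm s n]; omega,
      Nat.add_mul_div_left _ _ (by omega), Nat.div_eq_of_lt hin, zero_add]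

/-- A selection theorem: if every `n`-set contains a good `t`-set, then there are vertices `a j`
all of whose `t`-sets are good in suitable `n`-sets that are as disjoint as possible. -/
theorem exists_spread_good (n t J : ℕ) : ∃ N : ℕ, ∀ Good : Finset ℕ → Finset ℕ → Prop,
    (∀ A ⊆ Finset.range N, A.card = n → ∃ T ⊆ A, T.card = t ∧ Good T A) →
    ∃ (a : ℕ → ℕ) (E : Finset ℕ → Finset ℕ),
      (∀ j < J, a j < N) ∧ (∀ i < J, ∀ j < J, a i = a j → i = j) ∧
      ∀ Z ⊆ Finset.range J, Z.card = t →
        E Z ⊆ Finset.range N ∧ Good (Z.image a) (E Z) ∧ Z.image a ⊆ E Z ∧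
        (∀ j < J, a j ∈ E Z → j ∈ Z) ∧
        ∀ Z' ⊆ Finset.range J, Z'.card = t → Z ≠ Z' → ∀ x ∈ E Z, x ∈ E Z' →
          ∃ j ∈ Z, j ∈ Z' ∧ x = a j := by
  classical
  let enc : Finset ℕ → ℕ := Encodable.encode
  have henc : Function.Injective enc := Encodable.encode_injective
  let S : ℕ := (Finset.range J).powerset.sup enc
  have hS : ∀ Z ⊆ Finset.range J, enc Z ≤ S := fun Z hZ =>
    Finset.le_sup (f := enc) (Finset.mem_powerset.2 hZ)
  -- `D` is the width of a block: one slot for the vertex `a j` and `n` slots for each label up to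
  -- `S`. Blocks are numbered from `0` to `J`; block `0` precedes every vertex.
  let D : ℕ := n * (S + 1) + 1
  let M : ℕ := (J + 1) * D + n
  obtain ⟨N, hN⟩ := exists_uniform_position n t M
  refine ⟨N, fun Good hG => ?_⟩
  obtain ⟨Y, hYN, hYM, hY⟩ := hN Good hG
  obtain ⟨T, hTt, hT⟩ := hY (by simp only [M]; omega)
  have hcode : ∀ x : ℕ × ℕ, x.1 ≤ J → x.2 < D → x.1 * D + x.2 < M := by
    intro x h1 h2
    have := Nat.mul_le_mul_right D h1
    simp only [M, add_mul]
    omega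
  let y : ℕ × ℕ → ℕ := fun x => if h : x.1 * D + x.2 < M then
    Y.orderEmbOfFin hYM ⟨x.1 * D + x.2, h⟩ else 0
  have hyY : ∀ x : ℕ × ℕ, x.1 ≤ J → x.2 < D → y x ∈ Y := by
    intro x h1 h2
    simp only [y, dif_pos (hcode x h1 h2)]
    exact Finset.orderEmbOfFin_mem _ _ _
  have hymono : ∀ x z : ℕ × ℕ, x.1 ≤ J → x.2 < D → z.1 ≤ J → z.2 < D →
      toLex x < toLex z → y x < y z := by
    intro x z h1 h2 h3 h4 hlt
    simp only [y, dif_pos (hcode x h1 h2), dif_pos (hcode z h3 h4)]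
    rw [OrderEmbedding.lt_iff_lt, Fin.mk_lt_mk]
    rcases Prod.Lex.toLex_lt_toLex.1 hlt with h | ⟨h, h'⟩
    · have := Nat.mul_le_mul_right D (Nat.succ_le_of_lt h)
      rw [Nat.succ_mul] at this
      omega
    · rw [h]; omega
  have hyinj : ∀ x z : ℕ × ℕ, x.1 ≤ J → x.2 < D → z.1 ≤ J → z.2 < D → y x = y z → x = z := by
    intro x z h1 h2 h3 h4 h
    rcases lt_trichotomy (toLex x) (toLex z) with hlt | heq | hlt
    · exact absurd h (hymono x z h1 h2 h3 h4 hlt).ne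
    · exact toLex.injective heq
    · exact absurd h (hymono z x h3 h4 h1 h2 hlt).ne'
  -- The label of `Z` is its code `enc Z`, so an auxiliary slot determines the `Z` that uses it.
  have hf : ∀ Z ⊆ Finset.range J, Z.card = t → ∃ f : Fin n → ℕ × ℕ,
      StrictMono (fun i => toLex (f i)) ∧ T.image f = Z.image (fun j => (j + 1, 0)) ∧
      (∀ i, (f i).1 ≤ J ∧ (f i).2 < D) ∧
      ∀ i, (∃ j ∈ Z, f i = (j + 1, 0)) ∨ ((f i).2 ≠ 0 ∧ ((f i).2 - 1) / n = enc Z) := by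
    intro Z hZ hZt
    obtain ⟨f, hf, hfT, hfn⟩ := exists_strictMono_lex T Z (hZt.trans hTt.symm) (enc Z)
    have hin : ∀ i ∈ T, ∃ j ∈ Z, f i = (j + 1, 0) := by
      intro i hi
      have := Finset.mem_image_of_mem f hi
      rw [hfT] at this
      obtain ⟨j, hj, h⟩ := Finset.mem_image.1 this
      exact ⟨j, hj, h.symm⟩
    refine ⟨f, hf, hfT, fun i => ?_, fun i => ?_⟩
    · by_cases hi : i ∈ T
      · obtain ⟨j, hj, h⟩ := hin i hi
        have := Finset.mem_range.1 (hZ hj)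
        rw [h]
        simp only [D]
        omega
      · obtain ⟨-, h2, -, h3⟩ := hfn i hi
        have h4 : n * (enc Z + 1) ≤ n * (S + 1) :=
          Nat.mul_le_mul_left n (Nat.succ_le_succ (hS Z hZ))
        refine ⟨?_, by simp only [D]; omega⟩
        rcases h3 with h3 | ⟨j, hj, h3⟩
        · omega
        · have := Finset.mem_range.1 (hZ hj)
          omega
    · by_cases hi : i ∈ T
      · exact Or.inl (hin i hi)
      · exact Or.inr ⟨(hfn i hi).1, (hfn i hi).2.2.1⟩
  choose! f hf1 hf2 hf3 hf4 using hf
  have hD : 0 < D := Nat.succ_pos _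
  refine ⟨fun j => y (j + 1, 0), fun Z => Finset.univ.image fun i => y (f Z i), ?_, ?_, ?_⟩
  · exact fun j hj => Finset.mem_range.1 (hYN (hyY _ (Nat.succ_le_of_lt hj) hD))
  · intro i hi j hj h
    have := hyinj _ _ (Nat.succ_le_of_lt hi) hD (Nat.succ_le_of_lt hj) hD h
    simpa using this
  intro Z hZ hZt
  have hEY : ∀ i, y (f Z i) ∈ Y := fun i => hyY _ (hf3 Z hZ hZt i).1 (hf3 Z hZ hZt i).2
  have him : T.image (fun i => y (f Z i)) = Z.image fun j => y (j + 1, 0) := by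
    have := congrArg (Finset.image y) (hf2 Z hZ hZt)
    rwa [Finset.image_image, Finset.image_image] at this
  refine ⟨?_, ?_, ?_, ?_, ?_⟩
  · intro x hx
    obtain ⟨i, -, rfl⟩ := Finset.mem_image.1 hx
    exact hYN (hEY i)
  · rw [← him]
    refine hT _ (fun i j hij => ?_) hEY
    exact hymono _ _ (hf3 Z hZ hZt i).1 (hf3 Z hZ hZt i).2 (hf3 Z hZ hZt j).1
      (hf3 Z hZ hZt j).2 (hf1 Z hZ hZt hij)
  · rw [← him]
    exact Finset.image_subset_image (Finset.subset_univ _)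
  · intro j hj hx
    obtain ⟨i, -, h⟩ := Finset.mem_image.1 hx
    have h' := hyinj _ _ (hf3 Z hZ hZt i).1 (hf3 Z hZ hZt i).2 (Nat.succ_le_of_lt hj) hD h
    rcases hf4 Z hZ hZt i with ⟨j', hj', h1⟩ | ⟨h1, -⟩
    · rw [h1] at h'
      have : j' = j := by simpa using h'
      exact this ▸ hj'
    · rw [h'] at h1
      exact absurd rfl h1
  · intro Z' hZ' hZt' hne x hx hx'
    obtain ⟨i, -, rfl⟩ := Finset.mem_image.1 hx
    obtain ⟨i', -, h⟩ := Finset.mem_image.1 hx'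
    have h' := hyinj _ _ (hf3 Z' hZ' hZt' i').1 (hf3 Z' hZ' hZt' i').2 (hf3 Z hZ hZt i).1
      (hf3 Z hZ hZt i).2 h
    -- A common slot is a vertex slot for both sets, giving a common `j`. Mixed cases fail since
    -- auxiliary offsets are nonzero, and two auxiliary slots would force equal codes.
    rcases hf4 Z hZ hZt i with ⟨j, hj, h1⟩ | ⟨h1, h2⟩ <;>
      rcases hf4 Z' hZ' hZt' i' with ⟨j', hj', h3⟩ | ⟨h3, h4⟩
    · rw [h1, h3] at h'
      have hjj : j' = j := by simpa using h'
      exact ⟨j, hj, hjj ▸ hj', by rw [h1]⟩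
    · rw [h', h1] at h3
      exact absurd rfl h3
    · rw [← h', h3] at h1
      exact absurd rfl h1
    · rw [h', h2] at h4
      exact absurd (henc h4) hne

end Ramsey

/-! ### Chains of the full simplex and barycentric subdivision modulo 2 -/

section FiniteSetChains

/-- The chains modulo `2` on the full simplex with vertex set `ℕ`, in all degrees at once. -/
abbrev FullChain : Type := Finset ℕ →₀ ZMod 2

namespace FullChain

open Finsupp

/-- The augmented boundary operator of the full simplex. -/
def bd : FullChain →ₗ[ZMod 2] FullChain :=
  linearCombination (ZMod 2) fun σ => ∑ v ∈ σ, single (σ.erase v) 1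

/-- The cone with apex `x`. -/
def cone (x : ℕ) : FullChain →ₗ[ZMod 2] FullChain :=
  lmapDomain (ZMod 2) (ZMod 2) (insert x)

/-- The number of simplices of a chain modulo `2`. -/
def parity : FullChain →ₗ[ZMod 2] ZMod 2 :=
  linearCombination (ZMod 2) fun _ => 1

/-- The chains all of whose simplices satisfy a predicate. -/
def on (p : Finset ℕ → Prop) : Submodule (ZMod 2) FullChain :=
  supported (ZMod 2) (ZMod 2) {σ | p σ}

theorem bd_single (σ : Finset ℕ) : bd (single σ 1) = ∑ v ∈ σ, single (σ.erase v) 1 := by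
  simp [bd]

theorem cone_single (x : ℕ) (σ : Finset ℕ) : cone x (single σ 1) = single (insert x σ) 1 := by
  simp [cone]

theorem parity_single (σ : Finset ℕ) : parity (single σ 1) = 1 := by
  simp [parity]

theorem single_mem_on {p : Finset ℕ → Prop} {σ : Finset ℕ} (h : p σ) : single σ 1 ∈ on p :=
  single_mem_supported _ _ h

theorem on_induction {p : Finset ℕ → Prop} {M : Submodule (ZMod 2) FullChain}
    (h : ∀ σ, p σ → single σ 1 ∈ M) {c : FullChain} (hc : c ∈ on p) : c ∈ M := by
  have : on p ≤ M := by
    rw [on, supported_eq_span_single, Submodule.span_le]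
    rintro _ ⟨σ, hσ, rfl⟩
    exact h σ hσ
  exact this hc

theorem on_mono {p q : Finset ℕ → Prop} (h : ∀ σ, p σ → q σ) : on p ≤ on q :=
  supported_mono h

theorem eqOn_on {W : Type*} [AddCommGroup W] [Module (ZMod 2) W] {p : Finset ℕ → Prop}
    (f g : FullChain →ₗ[ZMod 2] W) (h : ∀ σ, p σ → f (single σ 1) = g (single σ 1))
    {c : FullChain} (hc : c ∈ on p) : f c = g c :=
  on_induction (M := LinearMap.eqLocus f g) h hc

/-- Removing two vertices in either order gives the same face, so the terms cancel in pairs. -/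
theorem bd_bd (c : FullChain) : bd (bd c) = 0 := by
  have : bd ∘ₗ bd = 0 := by
    ext1 σ
    refine LinearMap.ext_ring ?_
    simp only [LinearMap.comp_apply, lsingle_apply, LinearMap.zero_apply, bd_single, map_sum]
    rw [Finset.sum_sigma']
    refine Finset.sum_involution (fun x _ => ⟨x.2, x.1⟩) ?_ ?_ ?_ ?_
    · intro x _
      rw [Finset.erase_right_comm]
      exact ZModModule.add_self _
    · rintro ⟨x, y⟩ h - h'
      simp only [Finset.mem_sigma, Finset.mem_erase] at h
      exact h.2.1 (by simpa using congrArg Sigma.fst h')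
    · rintro ⟨x, y⟩ h
      simp only [Finset.mem_sigma, Finset.mem_erase] at h ⊢
      exact ⟨h.2.2, h.2.1.symm, h.1⟩
    · rintro ⟨x, y⟩ _
      rfl
  exact LinearMap.congr_fun this c

/-- Deleting the apex returns the base; deleting another vertex commutes with coning. The apex must
be new, since `insert` would otherwise not change the simplex. -/
theorem bd_cone {x : ℕ} {c : FullChain} (hc : c ∈ on (x ∉ ·)) :
    bd (cone x c) = c + cone x (bd c) := by
  refine eqOn_on (bd ∘ₗ cone x) (LinearMap.id + cone x ∘ₗ bd) (fun σ hσ => ?_) hc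
  simp only [LinearMap.comp_apply, LinearMap.add_apply, LinearMap.id_apply, cone_single, bd_single,
    map_sum]
  rw [Finset.sum_insert hσ, Finset.erase_insert hσ]
  congr 1
  refine Finset.sum_congr rfl fun v hv => ?_
  rw [Finset.erase_insert_of_ne (ne_of_mem_of_not_mem hv hσ).symm]

theorem parity_cone (x : ℕ) (c : FullChain) : parity (cone x c) = parity c := by
  have : parity ∘ₗ cone x = parity := by
    ext1 σ
    refine LinearMap.ext_ring ?_
    simp only [LinearMap.comp_apply, lsingle_apply, cone_single, parity_single]
  exact LinearMap.congr_fun this c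

/-- Combined with `parity_sd`, this kills any obstruction that is constant on the simplices of a
subdivision. -/
theorem map_eq_parity_smul {W : Type*} [AddCommGroup W] [Module (ZMod 2) W]
    {p : Finset ℕ → Prop} (f : FullChain →ₗ[ZMod 2] W) (w : W) (h : ∀ σ, p σ → f (single σ 1) = w)
    {c : FullChain} (hc : c ∈ on p) : f c = parity c • w :=
  eqOn_on f (LinearMap.toSpanSingleton (ZMod 2) W w ∘ₗ parity)
    (fun σ hσ => by simp [h σ hσ, parity_single]) hc

/-- The barycentric subdivision of the simplices with `n` vertices, where `a σ` is the barycentre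
of `σ`. -/
def sd (a : Finset ℕ → ℕ) : ℕ → Finset ℕ → FullChain
  | 0, _ => single ∅ 1
  | n + 1, σ => cone (a σ) (∑ v ∈ σ, sd a n (σ.erase v))

/-- The barycentres of the non-empty faces of a simplex. -/
def barycentres (a : Finset ℕ → ℕ) (σ : Finset ℕ) : Finset ℕ :=
  (σ.powerset.erase ∅).image a

theorem barycentres_mono (a : Finset ℕ → ℕ) {σ τ : Finset ℕ} (h : σ ⊆ τ) :
    barycentres a σ ⊆ barycentres a τ :=
  Finset.image_subset_image (Finset.erase_subset_erase _ (Finset.powerset_mono.2 h))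

variable {a : Finset ℕ → ℕ} {N : ℕ}

/-- The barycentres of distinct non-empty faces of the simplex on `N` vertices are distinct. -/
def InjOnFaces (a : Finset ℕ → ℕ) (N : ℕ) : Prop :=
  ∀ σ ⊆ Finset.range N, ∀ τ ⊆ Finset.range N, σ.Nonempty → τ.Nonempty → a σ = a τ → σ = τ

theorem InjOnFaces.notMem_barycentres (ha : InjOnFaces a N) {σ : Finset ℕ}
    (hσ : σ ⊆ Finset.range N) {v : ℕ} (hv : v ∈ σ) : a σ ∉ barycentres a (σ.erase v) := by
  intro h
  obtain ⟨ρ, hρ, h⟩ := Finset.mem_image.1 h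
  rw [Finset.mem_erase, Finset.mem_powerset] at hρ
  have := ha ρ (hρ.2.trans ((Finset.erase_subset _ _).trans hσ)) σ hσ
    (Finset.nonempty_iff_ne_empty.2 hρ.1) ⟨v, hv⟩ h
  exact Finset.notMem_erase v σ (hρ.2 (this ▸ hv))

theorem sd_mem (ha : InjOnFaces a N) (n : ℕ) : ∀ σ ⊆ Finset.range N, σ.card = n →
    sd a n σ ∈ on fun τ => τ.card = n ∧ τ ⊆ barycentres a σ := by
  induction n with
  | zero => exact fun σ _ _ => single_mem_on ⟨Finset.card_empty, Finset.empty_subset _⟩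
  | succ n ih =>
    intro σ hσ hn
    rw [sd, map_sum]
    refine Submodule.sum_mem _ fun v hv => ?_
    have h := ih (σ.erase v) ((Finset.erase_subset _ _).trans hσ)
      (by rw [Finset.card_erase_of_mem hv, hn]; rfl)
    refine on_induction (M := (on _).comap (cone (a σ))) (fun τ hτ => ?_) h
    rw [Submodule.mem_comap, cone_single]
    refine single_mem_on ⟨?_, ?_⟩
    · rw [Finset.card_insert_of_notMem fun h => ha.notMem_barycentres hσ hv (hτ.2 h), hτ.1]
    · refine Finset.insert_subset (Finset.mem_image_of_mem a ?_)
        (hτ.2.trans (barycentres_mono a (Finset.erase_subset _ _)))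
      rw [Finset.mem_erase, Finset.mem_powerset]
      exact ⟨(Finset.nonempty_iff_ne_empty.1 ⟨v, hv⟩), le_rfl⟩

/-- Subdivision is a chain map: by the cone formula the error is the cone over the subdivision of
`∂∂σ`, which is zero. -/
theorem bd_sd (ha : InjOnFaces a N) (n : ℕ) : ∀ σ ⊆ Finset.range N, σ.card = n + 1 →
    bd (sd a (n + 1) σ) = ∑ v ∈ σ, sd a n (σ.erase v) := by
  induction n with
  | zero =>
    intro σ hσ hn
    obtain ⟨v, rfl⟩ := Finset.card_eq_one.1 hn
    simp [sd, cone_single, bd_single]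
  | succ n ih =>
    intro σ hσ hn
    have hcard : ∀ v ∈ σ, (σ.erase v).card = n + 1 := fun v hv => by
      rw [Finset.card_erase_of_mem hv, hn]; rfl
    have hsub : ∀ v, σ.erase v ⊆ Finset.range N := fun v => (Finset.erase_subset _ _).trans hσ
    rw [sd, bd_cone]
    · rw [map_sum, Finset.sum_congr rfl fun v hv => ih _ (hsub v) (hcard v hv)]
      have h := congrArg (linearCombination (ZMod 2) (sd a n)) (bd_bd (single σ 1))
      simp only [bd_single, map_sum, linearCombination_single, one_smul, map_zero] at h
      rw [h, map_zero, add_zero]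
    · refine Submodule.sum_mem _ fun v hv => ?_
      refine on_mono (fun τ hτ h => ?_) (sd_mem ha (n + 1) _ (hsub v) (hcard v hv))
      exact ha.notMem_barycentres hσ hv (hτ.2 h)

/-- The subdivision has `(n + 2)!` simplices. An edge splits into two, and coning and summing
preserve evenness. -/
theorem parity_sd (a : Finset ℕ → ℕ) (n : ℕ) (σ : Finset ℕ) (hσ : σ.card = n + 2) :
    parity (sd a (n + 2) σ) = 0 := by
  induction n generalizing σ with
  | zero =>
    have h1 : ∀ τ : Finset ℕ, τ.card = 1 → parity (sd a 1 τ) = 1 := by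
      intro τ hτ
      simp [sd, parity_cone, parity_single, hτ]
    rw [sd, parity_cone, map_sum, Finset.sum_congr rfl fun v hv => h1 _ (by
      rw [Finset.card_erase_of_mem hv, hσ])]
    rw [Finset.sum_const, hσ]
    exact CharTwo.two_nsmul (1 : ZMod 2)
  | succ n ih =>
    rw [sd, parity_cone, map_sum]
    refine Finset.sum_eq_zero fun v hv => ih _ ?_
    rw [Finset.card_erase_of_mem hv, hσ]
    rfl

end FullChain

end FiniteSetChains

namespace HomMinor

/-! ### Singular chains supported in a subspace -/

section SingularSubspaces

variable {R : Type u} [TopologicalSpace R]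

/-- The singular chains all of whose simplices have image in `U`. -/
def chainsIn (U : Set R) (n : ℕ) : Submodule (ZMod 2) (SingularChain R n) :=
  Finsupp.supported (ZMod 2) (ZMod 2) {s | Set.range s ⊆ U}

theorem chainsIn_mono {U W : Set R} (h : U ⊆ W) (n : ℕ) : chainsIn U n ≤ chainsIn W n :=
  Finsupp.supported_mono fun _ hs => hs.trans h

theorem NonOverlapping.of_disjoint {U W : Set R} (h : Disjoint U W) {m n : ℕ}
    {c : SingularChain R m} {c' : SingularChain R n} (hc : c ∈ chainsIn U m)
    (hc' : c' ∈ chainsIn W n) : NonOverlapping c c' :=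
  fun _ hs _ ht => h.mono (hc hs) (hc' ht)

/-- The inclusion of the singular chains of a subspace. -/
def includeChains (U : Set R) (n : ℕ) : SingularChain U n →ₗ[ZMod 2] SingularChain R n :=
  Finsupp.lmapDomain (ZMod 2) (ZMod 2)
    fun s => (⟨Subtype.val, continuous_subtype_val⟩ : C(U, R)).comp s

theorem includeChains_injective (U : Set R) (n : ℕ) :
    Function.Injective (includeChains U n) := by
  refine Finsupp.mapDomain_injective fun s t h => ?_
  ext x
  exact DFunLike.congr_fun h x

theorem range_includeChains (U : Set R) (n : ℕ) :
    LinearMap.range (includeChains U n) = chainsIn U n := by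
  rw [includeChains, Finsupp.range_lmapDomain, chainsIn, Finsupp.supported_eq_span_single]
  congr 1
  ext c
  constructor
  · rintro ⟨s, rfl⟩
    refine ⟨_, ?_, rfl⟩
    rintro _ ⟨x, rfl⟩
    exact (s x).2
  · rintro ⟨s, hs, rfl⟩
    refine ⟨⟨fun x => ⟨s x, hs ⟨x, rfl⟩⟩, by fun_prop⟩, rfl⟩

theorem includeChains_single (U : Set R) (n : ℕ) (s : C(stdSimplex ℝ (Fin n), U)) :
    includeChains U n (Finsupp.single s 1) =
      Finsupp.single ((⟨Subtype.val, continuous_subtype_val⟩ : C(U, R)).comp s) 1 :=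
  Finsupp.mapDomain_single

theorem singularBoundary_single {X : Type u} [TopologicalSpace X] (n : ℕ)
    (s : C(stdSimplex ℝ (Fin (n + 1)), X)) :
    singularBoundary X n (Finsupp.single s 1) =
      ∑ i : Fin (n + 1), Finsupp.single (singularFace i s) 1 := by
  simp [singularBoundary]

theorem singularBoundary_includeChains (U : Set R) (n : ℕ) (c : SingularChain U (n + 1)) :
    singularBoundary R n (includeChains U (n + 1) c) =
      includeChains U n (singularBoundary U n c) := by
  have : singularBoundary R n ∘ₗ includeChains U (n + 1) =
      includeChains U n ∘ₗ singularBoundary U n := by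
    ext1 s
    refine LinearMap.ext_ring ?_
    simp only [LinearMap.comp_apply, Finsupp.lsingle_apply, includeChains_single,
      singularBoundary_single, map_sum]
    rfl
  exact LinearMap.congr_fun this c

/-- If the Betti number of a subspace is at most `b`, then being a boundary in the subspace is
detected on its cycles by a linear map to a `b`-dimensional space. -/
theorem exists_boundary_detector {U : Set R} {i b : ℕ} (h : reducedBetti U i ≤ b) :
    ∃ L : SingularChain R (i + 1) →ₗ[ZMod 2] (Fin b → ZMod 2), ∀ z ∈ chainsIn U (i + 1),
      singularBoundary R i z = 0 → L z = 0 →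
        ∃ w ∈ chainsIn U (i + 2), singularBoundary R (i + 1) w = z := by
  have hb : Cardinal.lift.{0} (Module.rank (ZMod 2) (ReducedHomology U i)) ≤
      Cardinal.lift.{u} (Module.rank (ZMod 2) (Fin b → ZMod 2)) := by
    simpa [reducedBetti] using h
  obtain ⟨g, hg⟩ := lift_rank_le_iff_exists_linearMap.1 hb
  -- Over a field the class map extends from cycles to all chains of `U`, and then through a linear
  -- retraction `q` to all chains of `R`. Its values carry meaning only on cycles in `U`.
  obtain ⟨e, he⟩ := LinearMap.exists_extend
    (g ∘ₗ (singularBoundaries U i).mkQ : singularCycles U i →ₗ[ZMod 2] (Fin b → ZMod 2))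
  obtain ⟨q, hq⟩ := (includeChains U (i + 1)).exists_leftInverse_of_injective
    (LinearMap.ker_eq_bot.2 (includeChains_injective U _))
  refine ⟨e ∘ₗ q, fun z hz hbz hLz => ?_⟩
  rw [← range_includeChains] at hz
  obtain ⟨c, rfl⟩ := hz
  rw [singularBoundary_includeChains] at hbz
  have hc : c ∈ singularCycles U i :=
    LinearMap.mem_ker.2 (includeChains_injective U i (by rw [hbz, map_zero]))
  have hqc : q (includeChains U (i + 1) c) = c := LinearMap.congr_fun hq c
  rw [LinearMap.comp_apply, hqc] at hLz
  have hec : e c = g ((singularBoundaries U i).mkQ ⟨c, hc⟩) := LinearMap.congr_fun he ⟨c, hc⟩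
  rw [hec] at hLz
  have h0 := hg (hLz.trans (map_zero g).symm)
  rw [Submodule.mkQ_apply, Submodule.Quotient.mk_eq_zero] at h0
  obtain ⟨w, hw⟩ := h0
  refine ⟨includeChains U (i + 2) w, ?_, ?_⟩
  · rw [← range_includeChains]
    exact ⟨w, rfl⟩
  · rw [singularBoundary_includeChains, hw]
    rfl

end SingularSubspaces

end HomMinor

namespace HomMinor

/-! ### Chain maps on skeleta, extended dimension by dimension -/

section SkeletonMaps

open FullChain

variable {R : Type u} [TopologicalSpace R]

/-- A non-trivial chain map from the simplices with at most `m` vertices of the simplex on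
`N` vertices to the singular chains of `R`, such that the image of `σ` lies in `U σ`. -/
structure SkeletonMap (U : Finset ℕ → Set R) (N m : ℕ)
    (γ : ∀ n, Finset ℕ → SingularChain R n) : Prop where
  zero : γ 0 ∅ ≠ 0
  mem : ∀ n ≤ m, ∀ σ ⊆ Finset.range N, σ.card = n → γ n σ ∈ chainsIn (U σ) n
  comm : ∀ n < m, ∀ σ ⊆ Finset.range N, σ.card = n + 1 →
    singularBoundary R n (γ (n + 1) σ) = ∑ v ∈ σ, γ n (σ.erase v)

/-- The linear extension of a function on finite sets. -/
def extend (γ : ∀ n, Finset ℕ → SingularChain R n) (n : ℕ) :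
    FullChain →ₗ[ZMod 2] SingularChain R n :=
  Finsupp.linearCombination (ZMod 2) (γ n)

theorem extend_single (γ : ∀ n, Finset ℕ → SingularChain R n) (n : ℕ) (σ : Finset ℕ) :
    extend γ n (Finsupp.single σ 1) = γ n σ := by
  simp [extend]

variable {U : Finset ℕ → Set R} {N m : ℕ} {γ : ∀ n, Finset ℕ → SingularChain R n}

theorem SkeletonMap.extend_mem (h : SkeletonMap U N m γ) (hU : Monotone U) {n : ℕ} (hn : n ≤ m)
    {B : Finset ℕ} (hB : B ⊆ Finset.range N) {c : FullChain}
    (hc : c ∈ on fun τ => τ.card = n ∧ τ ⊆ B) : extend γ n c ∈ chainsIn (U B) n := by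
  refine on_induction (M := (chainsIn (U B) n).comap (extend γ n)) (fun τ hτ => ?_) hc
  rw [Submodule.mem_comap, extend_single]
  exact chainsIn_mono (hU hτ.2) n (h.mem n hn τ (hτ.2.trans hB) hτ.1)

theorem SkeletonMap.extend_comm (h : SkeletonMap U N m γ) {n : ℕ} (hn : n < m) {c : FullChain}
    (hc : c ∈ on fun τ => τ.card = n + 1 ∧ τ ⊆ Finset.range N) :
    singularBoundary R n (extend γ (n + 1) c) = extend γ n (bd c) := by
  refine eqOn_on (singularBoundary R n ∘ₗ extend γ (n + 1)) (extend γ n ∘ₗ bd) (fun τ hτ => ?_) hc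
  simp only [LinearMap.comp_apply, extend_single, bd_single, map_sum]
  exact h.comm n hn τ hτ.2 hτ.1

theorem bd_mem_on {n : ℕ} {B : Finset ℕ} {c : FullChain}
    (hc : c ∈ on fun τ => τ.card = n + 1 ∧ τ ⊆ B) : bd c ∈ on fun τ => τ.card = n ∧ τ ⊆ B := by
  refine on_induction (M := (on _).comap bd) (fun τ hτ => ?_) hc
  rw [Submodule.mem_comap, bd_single]
  refine Submodule.sum_mem _ fun v hv => single_mem_on ⟨?_, ?_⟩
  · rw [Finset.card_erase_of_mem hv, hτ.1]
    rfl
  · exact (Finset.erase_subset _ _).trans hτ.2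

theorem isEmpty_stdSimplex {n : ℕ} (hn : n = 0) : IsEmpty (stdSimplex ℝ (Fin n)) := by
  subst hn
  exact ⟨fun y => by simpa using y.2.2⟩

/-- A choice of points of `R` defines a map on the `0`-skeleton. -/
theorem exists_skeletonMap_one (U : Finset ℕ → Set R) (N : ℕ) (hne : ∀ v < N, (U {v}).Nonempty) :
    ∃ γ, SkeletonMap U N 1 γ := by
  classical
  choose x hx using hne
  -- In degree `-1` the value is the unique empty singular simplex. Elsewhere `min'` only serves to
  -- read off the vertex of a singleton, the one case that matters.
  let e : ∀ n, Finset ℕ → SingularChain R n := fun n σ =>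
    if h : n = 0 then Finsupp.single ⟨fun y => (isEmpty_stdSimplex h).elim y,
      continuous_of_const fun y => (isEmpty_stdSimplex h).elim y⟩ 1
    else if h : ∃ h : σ.Nonempty, σ.min' h < N then
      Finsupp.single (ContinuousMap.const _ (x _ h.2)) 1 else 0
  have hempty := isEmpty_stdSimplex rfl
  have hsub : ∀ s t : C(stdSimplex ℝ (Fin 0), R), s = t := fun s t =>
    ContinuousMap.ext fun y => hempty.elim y
  refine ⟨e, ?_, ?_, ?_⟩
  · simp [e]
  · intro n hn σ hσ hc
    rcases Nat.le_one_iff_eq_zero_or_eq_one.1 hn with rfl | rfl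
    · intro s _
      rintro _ ⟨y, -⟩
      exact hempty.elim y
    · obtain ⟨v, rfl⟩ := Finset.card_eq_one.1 hc
      have hv := Finset.mem_range.1 (hσ (Finset.mem_singleton_self v))
      simp only [e, one_ne_zero, dif_neg, not_false_eq_true, Finset.singleton_nonempty, dif_pos,
        Finset.min'_singleton, hv, exists_const]
      refine Finsupp.single_mem_supported _ _ ?_
      rintro _ ⟨y, rfl⟩
      exact hx v hv
  · intro n hn σ hσ hc
    obtain rfl : n = 0 := by omega
    obtain ⟨v, rfl⟩ := Finset.card_eq_one.1 hc
    have hv := Finset.mem_range.1 (hσ (Finset.mem_singleton_self v))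
    simp only [e, zero_add, one_ne_zero, dif_neg, not_false_eq_true, Finset.singleton_nonempty,
      dif_pos, Finset.min'_singleton, Finset.sum_singleton, hv, exists_const]
    rw [singularBoundary_single]
    refine (Fin.sum_univ_one _).trans ?_
    congr 1
    exact hsub _ _

/-- This counts the barycentres needed to subdivide one face, and so fixes the size of the good
sets. -/
theorem card_image_faces {enc : Finset ℕ → ℕ} (henc : Function.Injective enc) {k : ℕ}
    {σ : Finset ℕ} (hσ : σ.card = k) : ((σ.powerset.erase ∅).image enc).card = 2 ^ k - 1 := by
  rw [Finset.card_image_of_injective _ henc,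
    Finset.card_erase_of_mem (Finset.empty_mem_powerset _), Finset.card_powerset, hσ]

/-- Extension of a map from the simplices with `k + 1` vertices to those with `k + 2` vertices,
after composition with a barycentric subdivision whose vertices are suitably chosen. -/
theorem exists_skeletonMap_succ (b k N : ℕ) : ∃ M : ℕ, ∀ (R : Type u) [TopologicalSpace R]
    (U : Finset ℕ → Set R), Monotone U →
    (∀ A ⊆ Finset.range M, reducedBetti (U A) k ≤ (b : Cardinal.{u})) →
    ∀ γ, SkeletonMap U M (k + 1) γ →
    ∃ (Ψ : Finset ℕ → Finset ℕ) (γ' : ∀ n, Finset ℕ → SingularChain R n), Monotone Ψ ∧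
      (∀ A ⊆ Finset.range N, Ψ A ⊆ Finset.range M) ∧
      (∀ A ⊆ Finset.range N, ∀ B ⊆ Finset.range N, Disjoint A B → Disjoint (Ψ A) (Ψ B)) ∧
      SkeletonMap (fun A => U (Ψ A)) N (k + 2) γ' := by
  classical
  -- The colours are the possible homology classes; the monochromatic set must hold a barycentre for
  -- each non-empty face of a simplex with `k + 2` vertices.
  obtain ⟨n, hn⟩ := exists_monochromatic ℕ (Fin b → ZMod 2) (k + 2) (2 ^ (k + 2) - 1)
  let enc : Finset ℕ → ℕ := Encodable.encode
  have henc : Function.Injective enc := Encodable.encode_injective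
  let J : ℕ := (Finset.range N).powerset.sup enc + 1
  have hJ : ∀ σ ⊆ Finset.range N, enc σ < J := fun σ hσ =>
    Nat.lt_succ_of_le (Finset.le_sup (f := enc) (Finset.mem_powerset.2 hσ))
  obtain ⟨M, hM⟩ := exists_spread_good n (2 ^ (k + 2) - 1) J
  refine ⟨M, fun R _ U hU hb γ hγ => ?_⟩
  choose! L hL using fun A hA => exists_boundary_detector (hb A hA)
  -- Good means that all `(k + 2)`-subsets of `T` have boundaries with one common value under the
  -- detector of the larger set `U A`.
  obtain ⟨a', E, haM, hainj, hE⟩ := hM (fun T A => ∃ c, ∀ τ ⊆ T, τ.card = k + 2 →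
      L A (extend γ (k + 1) (bd (Finsupp.single τ 1))) = c) (fun A hA hAc => by
    obtain ⟨c, T, hTA, hTc, hT⟩ := hn A hAc.ge
      fun τ => L A (extend γ (k + 1) (bd (Finsupp.single τ 1)))
    exact ⟨T, hTA, hTc, c, hT⟩)
  let a : Finset ℕ → ℕ := fun σ => a' (enc σ)
  have ha : InjOnFaces a N := fun σ hσ τ hτ _ _ h =>
    henc (hainj _ (hJ σ hσ) _ (hJ τ hτ) h)
  let Z : Finset ℕ → Finset ℕ := fun σ => (σ.powerset.erase ∅).image enc
  have hZJ : ∀ σ ⊆ Finset.range N, Z σ ⊆ Finset.range J := by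
    intro σ hσ j hj
    obtain ⟨ρ, hρ, rfl⟩ := Finset.mem_image.1 hj
    rw [Finset.mem_erase, Finset.mem_powerset] at hρ
    exact Finset.mem_range.2 (hJ ρ (hρ.2.trans hσ))
  have hZa : ∀ σ, (Z σ).image a' = barycentres a σ := fun σ => by
    simp only [Z, Finset.image_image]
    rfl
  have hZenc : ∀ σ ρ, enc ρ ∈ Z σ ↔ ρ.Nonempty ∧ ρ ⊆ σ := by
    intro σ ρ
    simp only [Z]
    rw [henc.mem_finset_image, Finset.mem_erase, Finset.mem_powerset,
      Finset.nonempty_iff_ne_empty]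
  have hbM : ∀ σ ⊆ Finset.range N, barycentres a σ ⊆ Finset.range M := by
    intro σ hσ x hx
    obtain ⟨ρ, hρ, rfl⟩ := Finset.mem_image.1 hx
    rw [Finset.mem_erase, Finset.mem_powerset] at hρ
    exact Finset.mem_range.2 (haM _ (hJ ρ (hρ.2.trans hσ)))
  have hfill : ∀ σ ⊆ Finset.range N, σ.card = k + 2 → ∃ w ∈ chainsIn (U (E (Z σ))) (k + 2),
      singularBoundary R (k + 1) w = ∑ v ∈ σ, extend γ (k + 1) (sd a (k + 1) (σ.erase v)) := by
    intro σ hσ hc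
    obtain ⟨hEM, ⟨c, hgood⟩, hZE, -, -⟩ := hE (Z σ) (hZJ σ hσ) (card_image_faces henc hc)
    rw [hZa] at hgood hZE
    have hsd := sd_mem ha (k + 2) σ hσ hc
    have hsd' : sd a (k + 2) σ ∈ on fun τ => τ.card = k + 1 + 1 ∧ τ ⊆ E (Z σ) :=
      on_mono (fun τ hτ => ⟨hτ.1, hτ.2.trans hZE⟩) hsd
    have hbd := bd_mem_on hsd'
    rw [← map_sum, ← bd_sd ha (k + 1) σ hσ hc]
    refine hL (E (Z σ)) hEM _ (hγ.extend_mem hU le_rfl hEM hbd) ?_ ?_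
    · rw [hγ.extend_comm (Nat.lt_succ_self k) (on_mono (fun τ hτ => ⟨hτ.1, hτ.2.trans hEM⟩) hbd),
        bd_bd, map_zero]
    -- Every simplex of the subdivision contributes the same `c`, and their number is even.
    · have := map_eq_parity_smul (L (E (Z σ)) ∘ₗ extend γ (k + 1) ∘ₗ bd) c
        (fun τ hτ => hgood τ hτ.2 hτ.1) hsd
      rw [parity_sd a k σ hc, zero_smul] at this
      exact this
  choose! w hw hbw using hfill
  -- The barycentres support the subdivided lower faces; the sets `E (Z σ)` are where the new
  -- fillings live.
  let Ψ : Finset ℕ → Finset ℕ := fun A => barycentres a A ∪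
    (A.powerset.filter fun σ => σ.card = k + 2).biUnion fun σ => E (Z σ)
  have hΨ : ∀ A x, x ∈ Ψ A ↔ (∃ ρ ⊆ A, ρ.Nonempty ∧ x = a ρ) ∨
      ∃ σ ⊆ A, σ.card = k + 2 ∧ x ∈ E (Z σ) := by
    intro A x
    simp only [Ψ, barycentres, Finset.mem_union, Finset.mem_image, Finset.mem_erase,
      Finset.mem_powerset, Finset.mem_biUnion, Finset.mem_filter, Finset.nonempty_iff_ne_empty]
    refine or_congr (exists_congr fun ρ => ?_) (exists_congr fun σ => and_assoc)
    rw [eq_comm, and_assoc, and_left_comm]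
  -- A barycentre `a ρ` can lie in `Ψ B` only if `ρ ⊆ B`, because `E (Z τ)` contains no barycentres
  -- but those of faces of `τ`.
  have hpair : ∀ A ⊆ Finset.range N, ∀ B ⊆ Finset.range N, Disjoint A B → ∀ ρ ⊆ A, ρ.Nonempty →
      a ρ ∉ Ψ B := by
    intro A hA B hB hAB ρ hρ hρn h
    have hρB : ρ ⊆ B := by
      rcases (hΨ B _).1 h with ⟨τ, hτ, hτn, h⟩ | ⟨τ, hτ, hτc, h⟩
      · rwa [ha ρ (hρ.trans hA) τ (hτ.trans hB) hρn hτn h]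
      · have := (hE (Z τ) (hZJ τ (hτ.trans hB)) (card_image_faces henc hτc)).2.2.2.1 _
          (hJ ρ (hρ.trans hA)) h
        exact ((hZenc _ _).1 this).2.trans hτ
    obtain ⟨x, hx⟩ := hρn
    exact Finset.disjoint_left.1 hAB (hρ hx) (hρB hx)
  -- The old map composed with subdivision, with the fillings `w` in the new top degree.
  refine ⟨Ψ, Function.update (fun n σ => extend γ n (sd a n σ)) (k + 2) w, ?_, ?_, ?_, ?_, ?_, ?_⟩
  · intro A B hAB x hx
    rw [hΨ] at hx ⊢
    rcases hx with ⟨ρ, hρ, h⟩ | ⟨σ, hσ, h⟩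
    · exact Or.inl ⟨ρ, hρ.trans hAB, h⟩
    · exact Or.inr ⟨σ, hσ.trans hAB, h⟩
  · intro A hA x hx
    rcases (hΨ A x).1 hx with ⟨ρ, hρ, hn, rfl⟩ | ⟨σ, hσ, hc, h⟩
    · exact Finset.mem_range.2 (haM _ (hJ ρ (hρ.trans hA)))
    · exact (hE (Z σ) (hZJ σ (hσ.trans hA)) (card_image_faces henc hc)).1 h
  · intro A hA B hB hAB
    refine Finset.disjoint_left.2 fun x hxA hxB => ?_
    rcases (hΨ A x).1 hxA with ⟨ρ, hρ, hρn, rfl⟩ | ⟨σ, hσ, hc, h⟩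
    · exact hpair A hA B hB hAB ρ hρ hρn hxB
    rcases (hΨ B x).1 hxB with ⟨ρ, hρ, hρn, rfl⟩ | ⟨τ, hτ, hc', h'⟩
    · exact hpair B hB A hA hAB.symm ρ hρ hρn hxA
    have hσn : σ.Nonempty := Finset.card_pos.1 (by omega)
    have hne : Z σ ≠ Z τ := by
      intro hZ
      have hmem : enc σ ∈ Z τ := hZ ▸ (hZenc σ σ).2 ⟨hσn, le_rfl⟩
      obtain ⟨y, hy⟩ := hσn
      exact Finset.disjoint_left.1 hAB (hσ hy) (hτ (((hZenc _ _).1 hmem).2 hy))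
    obtain ⟨j, hj, hj', rfl⟩ := (hE (Z σ) (hZJ σ (hσ.trans hA))
      (card_image_faces henc hc)).2.2.2.2 (Z τ) (hZJ τ (hτ.trans hB))
      (card_image_faces henc hc') hne x h h'
    obtain ⟨ρ, -, rfl⟩ := Finset.mem_image.1 hj
    obtain ⟨hρn, hρ⟩ := (hZenc _ _).1 hj
    exact hpair A hA B hB hAB ρ (hρ.trans hσ) hρn hxB
  · rw [Function.update_of_ne (by omega)]
    simpa [sd, extend_single] using hγ.zero
  · intro n hn σ hσ hc
    rcases hn.lt_or_eq with hn | rfl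
    · rw [Function.update_of_ne hn.ne]
      refine chainsIn_mono (hU ?_) n
        (hγ.extend_mem hU (Nat.le_of_lt_succ hn) (hbM σ hσ) (sd_mem ha n σ hσ hc))
      exact Finset.subset_union_left
    · rw [Function.update_self]
      refine chainsIn_mono (hU fun x hx => ?_) _ (hw σ hσ hc)
      exact (hΨ σ x).2 (Or.inr ⟨σ, le_rfl, hc, hx⟩)
  · intro n hn σ hσ hc
    rcases (Nat.le_of_lt_succ hn).lt_or_eq with hn' | rfl
    · rw [Function.update_of_ne (by omega), Function.update_of_ne (by omega),
        hγ.extend_comm hn' (on_mono (fun τ hτ => ⟨hτ.1, hτ.2.trans (hbM σ hσ)⟩)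
          (sd_mem ha _ σ hσ hc)), bd_sd ha n σ hσ hc, map_sum]
    · rw [Function.update_self, Function.update_of_ne (by omega)]
      exact hbw σ hσ hc

/-- For every large set of vertices whose hulls have bounded Betti numbers there is a map from the
skeleton of a simplex for which disjoint faces are mapped to hulls of disjoint sets. -/
theorem exists_skeletonMap (b m : ℕ) : ∀ N : ℕ, ∃ r : ℕ, ∀ (R : Type u) [TopologicalSpace R]
    (U : Finset ℕ → Set R), Monotone U → (∀ v < r, (U {v}).Nonempty) →
    (∀ k < m, ∀ A ⊆ Finset.range r, reducedBetti (U A) k ≤ (b : Cardinal.{u})) →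
    ∃ (Ψ : Finset ℕ → Finset ℕ) (γ : ∀ n, Finset ℕ → SingularChain R n), Monotone Ψ ∧
      (∀ A ⊆ Finset.range N, Ψ A ⊆ Finset.range r) ∧
      (∀ A ⊆ Finset.range N, ∀ B ⊆ Finset.range N, Disjoint A B → Disjoint (Ψ A) (Ψ B)) ∧
      SkeletonMap (fun A => U (Ψ A)) N (m + 1) γ := by
  induction m with
  | zero =>
    intro N
    refine ⟨N, fun R _ U hU hne _ => ?_⟩
    obtain ⟨γ, hγ⟩ := exists_skeletonMap_one U N hne
    exact ⟨id, γ, monotone_id, fun _ h => h, fun _ _ _ _ h => h, hγ⟩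
  | succ k ih =>
    intro N
    -- Each extension passes to a smaller simplex, so the sizes are chosen backwards: `M` for the
    -- last step, then `r` to reach `M`.
    obtain ⟨M, hM⟩ := exists_skeletonMap_succ.{u} b k N
    obtain ⟨r, hr⟩ := ih M
    refine ⟨r, fun R _ U hU hne hb => ?_⟩
    obtain ⟨Ψ, γ, hΨ, hΨr, hΨd, hγ⟩ := hr R U hU hne fun i hi => hb i (Nat.lt_succ_of_lt hi)
    obtain ⟨Ψ', γ', hΨ', hΨr', hΨd', hγ'⟩ := hM R (fun A => U (Ψ A)) (hU.comp hΨ)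
      (fun A hA => hb k (Nat.lt_succ_self k) _ (hΨr A hA)) γ hγ
    refine ⟨fun A => Ψ (Ψ' A), γ', hΨ.comp hΨ', fun A hA => hΨr _ (hΨr' A hA), ?_, hγ'⟩
    exact fun A hA B hB h => hΨd _ (hΨr' A hA) _ (hΨr' B hB) (hΨd' A hA B hB h)

end SkeletonMaps

end HomMinor

namespace HomMinor

/-! ### From skeleton maps to homological minors -/

section Conclusion

theorem mem_simplex_vertices {V : Type v} {K : PreAbstractSimplicialComplex V} {n : ℕ}
    (σ : Simplex K n) {v : V} (hv : v ∈ σ.1) : σ.1 ∈ K :=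
  σ.2.2 ⟨v, hv⟩

/-- A chain map on a sufficiently large skeleton of a simplex with values in disjoint sets on
disjoint faces exhibits a complex as a homological minor. -/
theorem SkeletonMap.isHomologicalMinor {V : Type v} {K : PreAbstractSimplicialComplex V}
    {R : Type u} [TopologicalSpace R] {U : Finset ℕ → Set R} {N m : ℕ}
    {γ : ∀ n, Finset ℕ → SingularChain R n} (h : SkeletonMap U N m γ)
    (hU : ∀ A ⊆ Finset.range N, ∀ B ⊆ Finset.range N, Disjoint A B → Disjoint (U A) (U B))
    (W : Finset V) (ι : V → ℕ) (hι : Set.InjOn ι W) (hιN : ∀ v ∈ W, ι v < N)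
    (hKW : ∀ σ ∈ K, σ ⊆ W) (hKm : ∀ σ ∈ K, σ.card ≤ m) : IsHomologicalMinor K R := by
  classical
  have hW : ∀ {n} (σ : Simplex K n), σ.1 ⊆ W := fun σ v hv =>
    hKW _ (mem_simplex_vertices σ hv) hv
  have hN : ∀ {n} (σ : Simplex K n), σ.1.image ι ⊆ Finset.range N := by
    intro n σ x hx
    obtain ⟨v, hv, rfl⟩ := Finset.mem_image.1 hx
    exact Finset.mem_range.2 (hιN v (hW σ hv))
  have hcard : ∀ {n} (σ : Simplex K n), (σ.1.image ι).card = n := fun σ => by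
    rw [Finset.card_image_of_injOn (hι.mono (hW σ)), σ.2.1]
  -- The mere existence of a simplex bounds its degree, so nothing is required of `γ` above the
  -- skeleton.
  have hle : ∀ {n} (_ : Simplex K (n + 1)), n < m := fun {n} σ => by
    obtain ⟨v, hv⟩ := Finset.card_pos.1 (σ.2.1.symm ▸ Nat.succ_pos n : 0 < σ.1.card)
    have := hKm _ (mem_simplex_vertices σ hv)
    rw [σ.2.1] at this
    omega
  have hle' : ∀ {n} (_ : Simplex K n), n ≤ m := fun {n} σ => by
    cases n with
    | zero => exact Nat.zero_le m
    | succ n => exact hle σ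
  let f : ∀ n, SimplicialChain K n →ₗ[ZMod 2] SingularChain R n := fun n =>
    Finsupp.linearCombination (ZMod 2) fun σ => γ n (σ.1.image ι)
  have hf : ∀ n (σ : Simplex K n), f n (Finsupp.single σ 1) = γ n (σ.1.image ι) := by
    intro n σ
    simp [f]
  refine ⟨⟨f, fun n c => ?_⟩, ?_, ?_⟩
  · have : singularBoundary R n ∘ₗ f (n + 1) = f n ∘ₗ simplicialBoundary K n := by
      ext1 σ
      refine LinearMap.ext_ring ?_
      simp only [LinearMap.comp_apply, Finsupp.lsingle_apply, hf, simplicialBoundary,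
        Finsupp.linearCombination_single, one_smul, map_sum]
      rw [h.comm n (hle σ) _ (hN σ) (hcard σ), Finset.sum_image (hι.mono (hW σ)),
        ← Finset.sum_coe_sort]
      refine Finset.sum_congr rfl fun v _ => congrArg (γ n) ?_
      ext x
      simp only [Simplex.facet, Finset.mem_erase, Finset.mem_image]
      constructor
      · rintro ⟨hx, w, hw, rfl⟩
        exact ⟨w, ⟨fun hwv => hx (hwv ▸ rfl), hw⟩, rfl⟩
      · rintro ⟨w, ⟨hwv, hw⟩, rfl⟩
        exact ⟨fun hwv' => hwv (hι (hW σ hw) (hW σ v.2) hwv'), w, hw, rfl⟩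
    exact LinearMap.congr_fun this c
  · let e : Simplex K 0 := ⟨∅, Finset.card_empty, fun h => absurd h Finset.not_nonempty_empty⟩
    have he : ∀ σ : Simplex K 0, σ = e := fun σ => Subtype.ext (Finset.card_eq_zero.1 σ.2.1)
    have : Unique (Simplex K 0) := ⟨⟨e⟩, he⟩
    have hempty := isEmpty_stdSimplex (rfl : 0 = 0)
    have : Unique C(stdSimplex ℝ (Fin 0), R) :=
      ⟨⟨⟨fun y => hempty.elim y, continuous_of_const fun y => hempty.elim y⟩⟩,
        fun s => ContinuousMap.ext fun y => hempty.elim y⟩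
    have hfin : Module.finrank (ZMod 2) (SimplicialChain K 0) =
        Module.finrank (ZMod 2) (SingularChain R 0) := by
      rw [Module.finrank_finsupp_self, Module.finrank_finsupp_self, Fintype.card_unique,
        Fintype.card_unique]
    -- Both groups in degree `-1` are one-dimensional, so a non-zero value on the empty simplex is
    -- enough.
    have hinj : Function.Injective (f 0) := by
      rw [injective_iff_map_eq_zero]
      intro c hc
      rw [Finsupp.unique_single c] at hc ⊢
      have hz : ∀ z : ZMod 2, z = 0 ∨ z = 1 := by decide
      rcases hz (c default) with hz | hz
      · rw [hz, Finsupp.single_zero]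
      · rw [hz, hf] at hc
        exact absurd hc (by simpa [he default, e] using h.zero)
    exact ⟨hinj, (LinearMap.injective_iff_surjective_of_finrank_eq_finrank hfin).1 hinj⟩
  · intro m' n σ τ hστ
    change NonOverlapping (f m' _) (f n _)
    rw [hf, hf]
    refine NonOverlapping.of_disjoint (hU _ (hN σ) _ (hN τ) ?_)
      (h.mem m' (hle' σ) _ (hN σ) (hcard σ)) (h.mem n (hle' τ) _ (hN τ) (hcard τ))
    refine Finset.disjoint_left.2 fun x hx hx' => ?_
    obtain ⟨v, hv, rfl⟩ := Finset.mem_image.1 hx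
    obtain ⟨w, hw, hvw⟩ := Finset.mem_image.1 hx'
    rw [hι (hW τ hw) (hW σ hv) hvw] at hw
    exact Finset.disjoint_left.1 hστ hv hw

theorem subset_convHull {X : Type u} (F : Set (Set X)) (S : Set X) : S ⊆ convHull F S :=
  Set.subset_sInter fun _ hA => hA.2

theorem convHull_mono {X : Type u} (F : Set (Set X)) {S T : Set X} (h : S ⊆ T) :
    convHull F S ⊆ convHull F T :=
  Set.sInter_subset_sInter fun _ hA => ⟨hA.1, h.trans hA.2⟩

theorem lt_dim {V : Type v} {K : PreAbstractSimplicialComplex V} {σ : Finset V} (hσ : σ ∈ K)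
    {k : ℕ} (hk : k + 1 < σ.card) : (k : WithBot ℕ∞) < dim K := by
  refine lt_of_lt_of_le ?_ (le_iSup₂_of_le σ hσ le_rfl)
  have : k < σ.card - 1 := by omega
  exact_mod_cast this

end Conclusion

end HomMinor

end

/-! ### The bound on the Radon number -/

open HomMinor in
theorem theoremt {V : Type v} (K : PreAbstractSimplicialComplex V) (hK : K.faces.Finite) (b : ℕ) :
    ∃ r : ℕ, ∀ (R : Type u) [TopologicalSpace R],
      HomMinor.IsForbiddenHomologicalMinor K R →
      ∀ F : Set (Set R),
        (∀ S : Set R, S.Finite → ∀ i : ℕ, (i : WithBot ℕ∞) < HomMinor.dim K →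
          HomMinor.reducedBetti (HomMinor.convHull F S) i ≤ (b : Cardinal.{u})) →
        HomMinor.radonNumber F ≤ (r : ℕ∞) := by
  classical
  let W : Finset V := hK.toFinset.biUnion id
  have hKW : ∀ σ ∈ K, σ ⊆ W := fun σ hσ =>
    Finset.subset_biUnion_of_mem id (hK.mem_toFinset.2 hσ)
  let m : ℕ := hK.toFinset.sup Finset.card
  have hKm : ∀ σ ∈ K, σ.card ≤ m := fun σ hσ => Finset.le_sup (hK.mem_toFinset.2 hσ)
  -- Faces with `m` vertices have dimension `m - 1`, so the Betti bounds cover exactly the `m - 1`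
  -- extension steps; for `m ≤ 1` there are none.
  have hdim : ∀ k < m - 1, (k : WithBot ℕ∞) < dim K := by
    intro k hk
    obtain ⟨σ, hσ, hc⟩ := (Finset.lt_sup_iff (a := k + 1)).1 (show k + 1 < m by omega)
    exact lt_dim (hK.mem_toFinset.1 hσ) hc
  let ι : V → ℕ := fun v => if h : v ∈ W then W.equivFin ⟨v, h⟩ else 0
  have hι : Set.InjOn ι W := by
    intro v hv w hw hvw
    have hv' : v ∈ W := hv
    have hw' : w ∈ W := hw
    simp only [ι, dif_pos hv', dif_pos hw'] at hvw
    simpa using W.equivFin.injective (Fin.ext hvw)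
  have hιN : ∀ v ∈ W, ι v < W.card := by
    intro v hv
    simp only [ι, dif_pos hv]
    exact Fin.is_lt _
  obtain ⟨r, hr⟩ := exists_skeletonMap.{u} b (m - 1) W.card
  refine ⟨r, fun R _ hforb F hF => iInf₂_le r ?_⟩
  intro P hP
  by_contra hno
  push Not at hno
  have e : Fin r ≃ P := (P.equivFinOfCardEq hP).symm
  -- The points of `P` are labelled by the numbers below `r`; larger labels contribute nothing.
  let pts : Finset ℕ → Finset R := fun A =>
    (Finset.univ.filter fun i : Fin r => (i : ℕ) ∈ A).image fun i => (e i : R)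
  have hpts : ∀ A x, x ∈ pts A ↔ ∃ i : Fin r, (i : ℕ) ∈ A ∧ (e i : R) = x := by
    intro A x
    simp [pts]
  have hmono : Monotone pts := by
    intro A B hAB x hx
    obtain ⟨i, hi, rfl⟩ := (hpts A x).1 hx
    exact (hpts B _).2 ⟨i, hAB hi, rfl⟩
  have hsub : ∀ A, pts A ⊆ P := by
    intro A x hx
    obtain ⟨i, -, rfl⟩ := (hpts A x).1 hx
    exact (e i).2
  have hdisj : ∀ A B : Finset ℕ, Disjoint A B → Disjoint (pts A) (pts B) := by
    intro A B hAB
    refine Finset.disjoint_left.2 fun x hx hx' => ?_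
    obtain ⟨i, hi, rfl⟩ := (hpts A x).1 hx
    obtain ⟨j, hj, hij⟩ := (hpts B _).1 hx'
    rw [e.injective (Subtype.ext hij)] at hj
    exact Finset.disjoint_left.1 hAB hi hj
  obtain ⟨Ψ, γ, -, -, hΨ, hγ⟩ := hr R (fun A => convHull F (pts A))
    (fun A B hAB => convHull_mono F (Finset.coe_subset.2 (hmono hAB)))
    (fun v hv => ⟨e ⟨v, hv⟩, subset_convHull F _
      ((hpts {v} _).2 ⟨⟨v, hv⟩, Finset.mem_singleton_self v, rfl⟩)⟩)
    (fun k hk A _ => hF _ (Finset.finite_toSet _) k (hdim k hk))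
  refine hforb (hγ.isHomologicalMinor (fun A hA B hB hAB => ?_) W ι hι hιN hKW
    fun σ hσ => (hKm σ hσ).trans (by omega))
  exact Set.disjoint_iff_inter_eq_empty.2
    (hno _ _ (hsub _) (hsub _) (hdisj _ _ (hΨ A hA B hB hAB)))
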